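/- Let $k$ be a field. All algebras are associative and unital, not necessarily commutative, and bigradings are indexed by $(p,q)\in\mathbb Z^2$; a module or algebra with a bigrading is identified with the direct sum of its pieces. A spectral sequence consists of bigraded $k$-vector spaces $E_r^{*,*}$ $(r\ge 1)$ with differentials $d_r\colon E_r^{p,q}\to E_r^{p+r,q-r+1}$, $d_r^2=0$, and isomorphisms $H(E_r,d_r)\cong E_{r+1}$ of bigraded vector spaces. It is \emph{multiplicative} if each $E_r$ is a bigraded $k$-algebra, $d_r(xy)=d_r(x)y+(-1)^{p+q}x\,d_r(y)$ for $x\in E_r^{p,q}$, and the isomorphisms $H(E_r)\cong E_{r+1}$ are isomorphisms of algebras. A spectral sequence $\widetilde E$ is a \emph{bigraded module} over $E$ if each $\widetilde E_r$ is a bigraded left $E_r$-module, $d_r(xm)=d_r(x)m+(-1)^{p+q}x\,d_r(m)$ for $x\in E_r^{p,q}$, and $H(\widetilde E_r)\cong\widetilde E_{r+1}$ is compatible with the actions. An element $x\in E_1$ is a \emph{permanent cycle} if $d_i$ vanishes on (the image in $E_i$ of) $x$ for all $i\ge 1$. Let $E_\infty$ be the algebra of permanent cycles of $E_1$ modulo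 the two-sided ideal of those whose image in some page is zero; it is bigraded, and $E_\infty^{*}$ denotes the same algebra graded by $E_\infty^n=\bigoplus_{p+q=n}E_\infty^{p,q}$. The $E_\infty^*$-module $\widetilde E_\infty^*$ is defined in the same way. For a bigraded algebra $C^{*,*}$, $\mathrm{Tot}(C^{*,*})$ is the same algebra graded by $\mathrm{Tot}(C)^n=\bigoplus_{p+q=n}C^{p,q}$. (a) Let $E$ be a multiplicative spectral sequence of bigraded $k$-algebras concentrated in the half plane $p+q\ge 0$ (that is, $E_1^{p,q}=0$ if $p+q<0$), and let $C^{*,*}$ be a bigraded $k$-algebra such that, for each fixed $q$, $C^{p,q}=0$ for $p$ sufficiently large. Assume that there is a homomorphism of bigraded algebras $\phi\colon C^{*,*}\to E_1^{*,*}$ such that (1) $\phi$ makes $E_1^{*,*}$ into a left Noetherian $C^{*,*}$-module, and (2) the image of $C^{*,*}$ in $E_1^{*,*}$ consists of permanent cycles. Then $E_\infty^{*}$, on which $c\in C$ acts as left multiplication by the class of $\phi(c)$, is a left Noetherian module over $\mathrm{Tot}(C^{*,*})$. (b) In the situation of (a), let $\widetilde E$ be a spectral sequence that is a bigraded module over the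 spectral sequence $E$. Assume that $\widetilde E_1^{*,*}$ is a left Noetherian module over $C^{*,*}$, where $C^{*,*}$ acts on $\widetilde E_1^{*,*}$ via $\phi$. Then $\widetilde E_\infty^{*}$ is a finitely generated $E_\infty^{*}$-module. -/

import Mathlib

/-- A (cohomologically graded) spectral sequence of bigraded `k`-vector spaces starting at the first
page.  `E r` is the total space `⨁_{p,q} E_{r+1}^{p,q}` of the page with number `r + 1`; its piece of
bidegree `(p, q)` is `deg r (p, q)`.  The differential of that page has bidegree `(r + 1, -r)`, and
its homology is identified, as a bigraded vector space, with the next page. -/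
structure BigradedSS (k : Type*) [Field k] (E : ℕ → Type*) [∀ r, AddCommGroup (E r)]
    [∀ r, Module k (E r)] where
  /-- the pieces of bidegree `(p, q)` -/
  deg : ∀ r, ℤ × ℤ → Submodule k (E r)
  /-- each page is the direct sum of its pieces -/
  [decomp : ∀ r, DirectSum.Decomposition (deg r)]
  /-- the differentials -/
  d : ∀ r, E r →ₗ[k] E r
  d_mem : ∀ (r : ℕ) (p q : ℤ) (x : E r), x ∈ deg r (p, q) →
    d r x ∈ deg r (p + ((r : ℤ) + 1), q - (r : ℤ))
  d_d : ∀ (r : ℕ) (x : E r), d r (d r x) = 0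
  /-- the homology of a page is the next page -/
  iso : ∀ r, ((LinearMap.ker (d r)) ⧸ (LinearMap.range (d r)).submoduleOf (LinearMap.ker (d r)))
    ≃ₗ[k] E (r + 1)
  iso_mem : ∀ (r : ℕ) (i : ℤ × ℤ) (x : LinearMap.ker (d r)), (x : E r) ∈ deg r i →
    iso r (Submodule.Quotient.mk x) ∈ deg (r + 1) i

namespace BigradedSS

attribute [instance] BigradedSS.decomp

section Pages

variable {k : Type*} [Field k] {E : ℕ → Type*} [∀ r, AddCommGroup (E r)] [∀ r, Module k (E r)]
  (S : BigradedSS k E)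

/-- The map sending a cycle of a page to its image in the next page. -/
def next (r : ℕ) : LinearMap.ker (S.d r) →ₗ[k] E (r + 1) :=
  (S.iso r).toLinearMap ∘ₗ Submodule.mkQ _

/-- `S.Survives n r x`: the first `n` differentials `d r, …, d (r + n - 1)` vanish on `x : E r`
(the later ones being applied to the image of `x` in the page concerned). -/
def Survives : ℕ → ∀ r, E r → Prop
  | 0, _, _ => True
  | n + 1, r, x => ∃ h : x ∈ LinearMap.ker (S.d r), Survives n (r + 1) (S.next r ⟨x, h⟩)

/-- `S.Dies n r x`: the element `x : E r` survives to the page `E (r + n)` and its image there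
is zero. -/
def Dies : ℕ → ∀ r, E r → Prop
  | 0, _, x => x = 0
  | n + 1, r, x => ∃ h : x ∈ LinearMap.ker (S.d r), Dies n (r + 1) (S.next r ⟨x, h⟩)

/-- Permanent cycles: all differentials from this page on vanish on (the images of) `x`. -/
def IsPermanentCycle (r : ℕ) (x : E r) : Prop := ∀ n, S.Survives n r x

/-- Elements which become zero on some later page. -/
def IsEventualBoundary (r : ℕ) (x : E r) : Prop := ∃ n, S.Dies n r x

variable {S}

theorem survives_zero (n r : ℕ) : S.Survives n r 0 := by
  induction n generalizing r with
  | zero => trivial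
  | succ n ih =>
    refine ⟨zero_mem _, ?_⟩
    have : S.next r ⟨0, zero_mem _⟩ = 0 := map_zero (S.next r)
    rw [this]; exact ih _

theorem Survives.add {n r : ℕ} {x y : E r} (hx : S.Survives n r x) (hy : S.Survives n r y) :
    S.Survives n r (x + y) := by
  induction n generalizing r with
  | zero => trivial
  | succ n ih =>
    obtain ⟨h, hx⟩ := hx
    obtain ⟨h', hy⟩ := hy
    refine ⟨add_mem h h', ?_⟩
    have : S.next r ⟨x + y, add_mem h h'⟩ = S.next r ⟨x, h⟩ + S.next r ⟨y, h'⟩ :=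
      map_add (S.next r) ⟨x, h⟩ ⟨y, h'⟩
    rw [this]; exact ih hx hy

theorem Survives.smul {n r : ℕ} (a : k) {x : E r} (hx : S.Survives n r x) :
    S.Survives n r (a • x) := by
  induction n generalizing r with
  | zero => trivial
  | succ n ih =>
    obtain ⟨h, hx⟩ := hx
    refine ⟨Submodule.smul_mem _ a h, ?_⟩
    have : S.next r ⟨a • x, Submodule.smul_mem _ a h⟩ = a • S.next r ⟨x, h⟩ :=
      map_smul (S.next r) a ⟨x, h⟩
    rw [this]; exact ih hx

theorem dies_zero (n r : ℕ) : S.Dies n r 0 := by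
  induction n generalizing r with
  | zero => rfl
  | succ n ih =>
    refine ⟨zero_mem _, ?_⟩
    have : S.next r ⟨0, zero_mem _⟩ = 0 := map_zero (S.next r)
    rw [this]; exact ih _

theorem Dies.add {n m r : ℕ} {x y : E r} (hx : S.Dies n r x) (hy : S.Dies m r y) :
    S.Dies (max n m) r (x + y) := by
  induction n generalizing r m with
  | zero =>
    rw [show x = 0 from hx, zero_add]; simpa using hy
  | succ n ih =>
    cases m with
    | zero => rw [show y = 0 from hy, add_zero]; exact hx
    | succ m =>
      obtain ⟨h, hx⟩ := hx
      obtain ⟨h', hy⟩ := hy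
      rw [Nat.succ_max_succ]
      refine ⟨add_mem h h', ?_⟩
      have : S.next r ⟨x + y, add_mem h h'⟩ = S.next r ⟨x, h⟩ + S.next r ⟨y, h'⟩ :=
        map_add (S.next r) ⟨x, h⟩ ⟨y, h'⟩
      rw [this]; exact ih hx hy

/-- Bidegree-wise components of cycles are cycles. -/
theorem d_component {r : ℕ} {x : E r} (h : S.d r x = 0) (i : ℤ × ℤ) :
    S.d r (DirectSum.decompose (S.deg r) x i : E r) = 0 := by
  have key : ∀ y : E r, S.d r (DirectSum.decompose (S.deg r) y i : E r) =
      DirectSum.decompose (S.deg r) (S.d r y) (i.1 + ((r : ℤ) + 1), i.2 - (r : ℤ)) := by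
    intro y
    induction y using DirectSum.Decomposition.inductionOn (S.deg r) with
    | zero => simp
    | @homogeneous j m =>
      have hm := S.d_mem r j.1 j.2 m m.2
      by_cases hij : j = i
      · subst hij
        rw [DirectSum.decompose_of_mem_same _ m.2, DirectSum.decompose_of_mem_same _ hm]
      · rw [DirectSum.decompose_of_mem_ne _ m.2 hij, DirectSum.decompose_of_mem_ne _ hm, map_zero]
        intro he
        rw [Prod.mk.injEq] at he
        exact hij (Prod.ext (by linarith [he.1]) (by linarith [he.2]))
    | add a b ha hb => simp [DirectSum.decompose_add, ha, hb]
  rw [key, h]; simp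

end Pages

section Multiplicative

variable {k : Type*} [Field k] {E : ℕ → Type*} [∀ r, Ring (E r)] [∀ r, Algebra k (E r)]

/-- A multiplicative spectral sequence: every page is a bigraded `k`-algebra, the differentials
satisfy the graded Leibniz rule, and the identification of the homology of a page with the next
page is multiplicative. -/
class IsMultiplicative (S : BigradedSS k E) : Prop where
  one_mem : ∀ r, (1 : E r) ∈ S.deg r (0, 0)
  mul_mem : ∀ (r : ℕ) (i j : ℤ × ℤ) (x y : E r), x ∈ S.deg r i → y ∈ S.deg r j →
    x * y ∈ S.deg r (i + j)
  leibniz : ∀ (r : ℕ) (p q : ℤ) (x y : E r), x ∈ S.deg r (p, q) →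
    S.d r (x * y) = S.d r x * y + (p + q).negOnePow • (x * S.d r y)
  iso_mul : ∀ (r : ℕ) (x y z : LinearMap.ker (S.d r)), (z : E r) = (x : E r) * (y : E r) →
    S.iso r (Submodule.Quotient.mk z) =
      S.iso r (Submodule.Quotient.mk x) * S.iso r (Submodule.Quotient.mk y)

variable {M : ℕ → Type*} [∀ r, AddCommGroup (M r)] [∀ r, Module k (M r)] [∀ r, Module (E r) (M r)]

/-- A bigraded module over a multiplicative spectral sequence: every page is a bigraded left module
over the corresponding page, compatibly with the differentials (graded Leibniz rule) and with the
identification of homology with the next page. -/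
class IsModuleOver (T : BigradedSS k M) (S : BigradedSS k E) : Prop where
  smul_mem : ∀ (r : ℕ) (i j : ℤ × ℤ) (x : E r) (m : M r), x ∈ S.deg r i → m ∈ T.deg r j →
    x • m ∈ T.deg r (i + j)
  leibniz : ∀ (r : ℕ) (p q : ℤ) (x : E r) (m : M r), x ∈ S.deg r (p, q) →
    T.d r (x • m) = S.d r x • m + (p + q).negOnePow • (x • T.d r m)
  iso_smul : ∀ (r : ℕ) (x : LinearMap.ker (S.d r)) (m n : LinearMap.ker (T.d r)),
    (n : M r) = (x : E r) • (m : M r) →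
    T.iso r (Submodule.Quotient.mk n) =
      S.iso r (Submodule.Quotient.mk x) • T.iso r (Submodule.Quotient.mk m)

instance (S : BigradedSS k E) [IsMultiplicative S] : IsModuleOver S S where
  smul_mem := IsMultiplicative.mul_mem
  leibniz := IsMultiplicative.leibniz
  iso_smul := IsMultiplicative.iso_mul

section Action

variable {S : BigradedSS k E} {T : BigradedSS k M} [IsModuleOver T S]

theorem smul_mem_ker {r : ℕ} {x : E r} {m : M r} (hx : x ∈ LinearMap.ker (S.d r))
    (hm : m ∈ LinearMap.ker (T.d r)) :
    x • m ∈ LinearMap.ker (T.d r) := by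
  classical
  rw [LinearMap.mem_ker] at *
  rw [← DirectSum.sum_support_decompose (S.deg r) x, Finset.sum_smul, map_sum]
  refine Finset.sum_eq_zero fun i _ => ?_
  rw [IsModuleOver.leibniz (S := S) (T := T) r i.1 i.2 _ m (SetLike.coe_mem _),
    d_component hx, hm]
  simp

theorem next_smul {r : ℕ} {x : E r} {m : M r} (hx : x ∈ LinearMap.ker (S.d r))
    (hm : m ∈ LinearMap.ker (T.d r)) :
    T.next r ⟨x • m, smul_mem_ker hx hm⟩ = S.next r ⟨x, hx⟩ • T.next r ⟨m, hm⟩ :=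
  IsModuleOver.iso_smul r ⟨x, hx⟩ ⟨m, hm⟩ ⟨x • m, smul_mem_ker hx hm⟩ rfl

theorem Survives.act {n r : ℕ} {x : E r} {m : M r} (hx : S.Survives n r x)
    (hm : T.Survives n r m) : T.Survives n r (x • m) := by
  induction n generalizing r with
  | zero => trivial
  | succ n ih =>
    obtain ⟨h, hx⟩ := hx
    obtain ⟨h', hm⟩ := hm
    exact ⟨smul_mem_ker h h', by rw [next_smul h h']; exact ih hx hm⟩

theorem Dies.act {n r : ℕ} {x : E r} {m : M r} (hx : S.Survives n r x)
    (hm : T.Dies n r m) : T.Dies n r (x • m) := by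
  induction n generalizing r with
  | zero => rw [show m = 0 from hm, smul_zero]; rfl
  | succ n ih =>
    obtain ⟨h, hx⟩ := hx
    obtain ⟨h', hm⟩ := hm
    exact ⟨smul_mem_ker h h', by rw [next_smul h h']; exact ih hx hm⟩

theorem Dies.act_left {n r : ℕ} {x : E r} {m : M r} (hx : S.Dies n r x)
    (hm : T.Survives n r m) : T.Dies n r (x • m) := by
  induction n generalizing r with
  | zero => rw [show x = 0 from hx, zero_smul]; rfl
  | succ n ih =>
    obtain ⟨h, hx⟩ := hx
    obtain ⟨h', hm⟩ := hm
    exact ⟨smul_mem_ker h h', by rw [next_smul h h']; exact ih hx hm⟩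

end Action

theorem isPermanentCycle_one (S : BigradedSS k E) [IsMultiplicative S] (r : ℕ) :
    S.IsPermanentCycle r 1 := by
  intro n
  induction n generalizing r with
  | zero => trivial
  | succ n ih =>
    have h : 1 ∈ LinearMap.ker (S.d r) := by
      have := IsMultiplicative.leibniz (S := S) r 0 0 1 1 (IsMultiplicative.one_mem r)
      simpa using this
    refine ⟨h, ?_⟩
    have h1 : S.next r ⟨1, h⟩ = 1 := by
      have hs : Function.Surjective (S.next r) :=
        (S.iso r).surjective.comp (Submodule.mkQ_surjective _)
      obtain ⟨⟨y, hy⟩, hy1⟩ := hs 1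
      have hmul : S.next r ⟨y, hy⟩ = S.next r ⟨1, h⟩ * S.next r ⟨y, hy⟩ :=
        IsMultiplicative.iso_mul r ⟨1, h⟩ ⟨y, hy⟩ ⟨y, hy⟩ (one_mul y).symm
      rw [hy1, mul_one] at hmul
      exact hmul.symm
    rw [h1]; exact ih _

variable (S : BigradedSS k E) [IsMultiplicative S]

/-- The algebra of permanent cycles in the first page. -/
def permanentCycles : Subalgebra k (E 0) where
  carrier := {x | S.IsPermanentCycle 0 x}
  mul_mem' hx hy n := (hx n).act (T := S) (hy n)
  add_mem' hx hy n := (hx n).add (hy n)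
  algebraMap_mem' a n := by
    rw [Algebra.algebraMap_eq_smul_one]
    exact (isPermanentCycle_one S 0 n).smul a

/-- The ideal of those permanent cycles that become zero on some page. -/
def eventualBoundaries : Ideal S.permanentCycles where
  carrier := {x | S.IsEventualBoundary 0 (x : E 0)}
  add_mem' := by rintro x y ⟨n, hx⟩ ⟨m, hy⟩; exact ⟨_, hx.add hy⟩
  zero_mem' := ⟨0, rfl⟩
  smul_mem' := by rintro c x ⟨n, hx⟩; exact ⟨n, hx.act (S := S) (c.2 n)⟩

instance : S.eventualBoundaries.IsTwoSided where
  mul_mem_of_left {a} b ha := by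
    obtain ⟨n, hn⟩ := ha
    exact ⟨n, hn.act_left (T := S) (b.2 n)⟩

/-- The algebra `E_∞^* = ⨁_n ⨁_{p+q=n} E_∞^{p,q}`: permanent cycles of the first page modulo those
which become zero on some page, with the induced product. -/
abbrev EInf : Type _ := S.permanentCycles ⧸ S.eventualBoundaries

variable (T : BigradedSS k M) [IsModuleOver T S]

/-- The permanent cycles in the first page of a module spectral sequence, as a module over the
algebra of permanent cycles. -/
def modCycles : Submodule S.permanentCycles (M 0) where
  carrier := {m | T.IsPermanentCycle 0 m}
  add_mem' hx hy n := (hx n).add (hy n)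
  zero_mem' n := survives_zero n 0
  smul_mem' c _ hm n := (c.2 n).act (hm n)

/-- The permanent cycles that become zero on some page. -/
def modBoundaries : Submodule S.permanentCycles (modCycles S T) where
  carrier := {m | T.IsEventualBoundary 0 (m : M 0)}
  add_mem' := by rintro x y ⟨n, hx⟩ ⟨m, hy⟩; exact ⟨_, hx.add hy⟩
  zero_mem' := ⟨0, rfl⟩
  smul_mem' := by rintro c x ⟨n, hx⟩; exact ⟨n, hx.act (c.2 n)⟩

/-- The infinity page `Ẽ_∞^* = ⨁_n ⨁_{p+q=n} Ẽ_∞^{p,q}` of a module spectral sequence `T`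
over `S`. -/
abbrev ModEInf : Type _ := modCycles S T ⧸ modBoundaries S T

/-- The action of `E_∞^*` on `Ẽ_∞^*`: the class of `x` acts on the class of `m` with result the
class of `x • m`. -/
instance : Module S.EInf (ModEInf S T) :=
  Module.IsTorsionBySet.module (I := S.eventualBoundaries) <| by
    rintro m ⟨a, n, ha⟩
    obtain ⟨m, rfl⟩ := Submodule.Quotient.mk_surjective _ m
    exact (Submodule.Quotient.mk_eq_zero _).2 ⟨n, ha.act_left (m.2 n)⟩

/-- The algebra map `C → E_∞^*` induced by an algebra map `φ : C → E_1` whose image consists of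
permanent cycles. -/
def toEInf {C : Type*} [Ring C] [Algebra k C] (φ : C →ₐ[k] E 0)
    (hφ : ∀ c, S.IsPermanentCycle 0 (φ c)) : C →ₐ[k] S.EInf :=
  (Ideal.Quotient.mkₐ k S.eventualBoundaries).comp (φ.codRestrict S.permanentCycles hφ)

end Multiplicative

end BigradedSS

/-- The left `A`-module `M` is a Noetherian left module over `C`, where `C` acts through the
ring homomorphism `f : C → A`. -/
def IsNoetherianVia {C A : Type*} [Ring C] [Ring A] (f : C →+* A) (M : Type*) [AddCommGroup M]
    [Module A M] : Prop :=
  letI : Module C M := Module.compHom M f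
  IsNoetherian C M

/-! The infinity page is a subquotient of the first page, and over `C` both steps are linear. By the
Leibniz rule a permanent cycle times a permanent cycle is permanent; since `φ` takes values in
permanent cycles, these form a `C`-submodule of the first page, and the eventual boundaries form a
`C`-submodule of them. Noetherianity passes to submodules (`of_injective`) and quotients
(`of_surjective`), for `S` and for `T` alike. For (b), `C` acts on the infinity page of `T` through
`S.EInf`, so finitely many generators over `C` also generate over `S.EInf` (`finite`). The ring
acting changes along the way, from `E 0` to the permanent cycles to `S.EInf`; hence the transfer
lemmas allow different rings on the two sides and ask only for compatibility over `C`. -/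

namespace IsNoetherianVia

variable {C A B : Type*} [Ring C] [Ring A] [Ring B] {f : C →+* A} {g : C →+* B}
  {M N : Type*} [AddCommGroup M] [Module A M] [AddCommGroup N] [Module B N]

/-- Noetherianity passes to the target of a surjective map compatible with the actions of `C`. -/
theorem of_surjective (hM : IsNoetherianVia f M) (h : M →+ N)
    (hsmul : ∀ (c : C) (m : M), h (f c • m) = g c • h m) (hh : Function.Surjective h) :
    IsNoetherianVia g N := by
  let _ : Module C M := Module.compHom M f
  let _ : Module C N := Module.compHom N g
  have : IsNoetherian C M := hM
  let l : M →ₗ[C] N := { h with map_smul' := hsmul }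
  exact isNoetherian_of_surjective l (LinearMap.range_eq_top.2 hh)

/-- Noetherianity passes to the source of an injective map compatible with the actions of `C`. -/
theorem of_injective (hN : IsNoetherianVia g N) (h : M →+ N)
    (hsmul : ∀ (c : C) (m : M), h (f c • m) = g c • h m) (hh : Function.Injective h) :
    IsNoetherianVia f M := by
  let _ : Module C M := Module.compHom M f
  let _ : Module C N := Module.compHom N g
  have : IsNoetherian C N := hN
  let l : M →ₗ[C] N := { h with map_smul' := hsmul }
  exact isNoetherian_of_injective l hh

/-- A module that is Noetherian through `f : C → A` is finitely generated over `A`. -/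
theorem finite (hM : IsNoetherianVia f M) : Module.Finite A M := by
  let _ : Module C M := Module.compHom M f
  let _ : Module C A := Module.compHom A f
  have : IsNoetherian C M := hM
  -- `C` acts on both `A` and `M` through `f`, so associativity is that of the `A`-action. The tower
  -- places the `C`-span of a set inside its `A`-span.
  have : IsScalarTower C A M := ⟨fun c a m => mul_smul (f c) a m⟩
  exact Module.Finite.of_restrictScalars_finite C A M

end IsNoetherianVia

/-! ### Infinity pages as subquotients of first pages -/

namespace BigradedSS

variable {k : Type*} [Field k] {E : ℕ → Type*} [∀ r, Ring (E r)] [∀ r, Algebra k (E r)]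
  {S : BigradedSS k E} [S.IsMultiplicative] {C : Type*} [Ring C] [Algebra k C]
  {φ : C →ₐ[k] E 0} (hφ : ∀ c, S.IsPermanentCycle 0 (φ c))

/-- If the first page is Noetherian over `C`, then so is the infinity page: the permanent cycles
are a `C`-submodule of the first page, and the infinity page is a quotient of them. -/
theorem isNoetherianVia_eInf (h : IsNoetherianVia (φ : C →+* E 0) (E 0)) :
    IsNoetherianVia (S.toEInf φ hφ : C →+* S.EInf) S.EInf := by
  have hZ : IsNoetherianVia (φ.codRestrict S.permanentCycles hφ : C →+* S.permanentCycles)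
      S.permanentCycles :=
    h.of_injective S.permanentCycles.val.toAddMonoidHom (fun _ _ => rfl) Subtype.val_injective
  -- Compatibility is definitional: `toEInf` is the corestriction of `φ` followed by this quotient
  -- map.
  exact hZ.of_surjective (Ideal.Quotient.mk S.eventualBoundaries).toAddMonoidHom
    (fun _ _ => rfl) Ideal.Quotient.mk_surjective

variable {M : ℕ → Type*} [∀ r, AddCommGroup (M r)] [∀ r, Module k (M r)] [∀ r, Module (E r) (M r)]
  {T : BigradedSS k M} [T.IsModuleOver S]

/-- If the first page of a module spectral sequence is Noetherian over `C`, then so is its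
infinity page. -/
theorem isNoetherianVia_modEInf (h : IsNoetherianVia (φ : C →+* E 0) (M 0)) :
    IsNoetherianVia (S.toEInf φ hφ : C →+* S.EInf) (ModEInf S T) := by
  -- `modCycles S T` carries an action of the permanent cycles only, not of all of `E 0`, so `φ` has
  -- to be corestricted before `C` can act.
  have hZ : IsNoetherianVia (φ.codRestrict S.permanentCycles hφ : C →+* S.permanentCycles)
      (modCycles S T) :=
    h.of_injective (modCycles S T).subtype.toAddMonoidHom (fun _ _ => rfl) Subtype.val_injective
  exact hZ.of_surjective (modBoundaries S T).mkQ.toAddMonoidHom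
    (fun _ _ => rfl) (Submodule.mkQ_surjective _)

end BigradedSS

theorem mainTheorem3 {k : Type*} [Field k]
    {E : ℕ → Type*} [∀ r, Ring (E r)] [∀ r, Algebra k (E r)]
    (S : BigradedSS k E) [S.IsMultiplicative]
    (hS : ∀ p q : ℤ, p + q < 0 → S.deg 0 (p, q) = ⊥)
    {C : Type*} [Ring C] [Algebra k C] (𝒞 : ℤ × ℤ → Submodule k C) [GradedAlgebra 𝒞]
    (hC : ∀ q : ℤ, ∃ p₀ : ℤ, ∀ p : ℤ, p₀ ≤ p → 𝒞 (p, q) = ⊥)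
    (φ : C →ₐ[k] E 0) (hφ_deg : ∀ (i : ℤ × ℤ) (c : C), c ∈ 𝒞 i → φ c ∈ S.deg 0 i)
    (hφ_noeth : IsNoetherianVia (φ : C →+* E 0) (E 0))
    (hφ_perm : ∀ c : C, S.IsPermanentCycle 0 (φ c)) :
    IsNoetherianVia (S.toEInf φ hφ_perm : C →+* S.EInf) S.EInf ∧
    ∀ {M : ℕ → Type*} [∀ r, AddCommGroup (M r)] [∀ r, Module k (M r)] [∀ r, Module (E r) (M r)]
      [∀ r, IsScalarTower k (E r) (M r)] (T : BigradedSS k M) [T.IsModuleOver S],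
      IsNoetherianVia (φ : C →+* E 0) (M 0) →
      Module.Finite S.EInf (BigradedSS.ModEInf S T) :=

  ⟨S.isNoetherianVia_eInf hφ_perm hφ_noeth,
    -- Noetherianity over `C` is stronger than needed here: only finite generation is kept when
    -- passing to `S.EInf`.
    fun _ _ hT => (BigradedSS.isNoetherianVia_modEInf hφ_perm hT).finite⟩
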